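/- For a positive integer $k$, let $D_k$ be the set of all integers $m$ that occur among the denominators of some identity \[ 1=\frac1{n_1}+\frac1{n_2}+\cdots+\frac1{n_k} \] with exactly $k$ terms and integers $1\le n_1<n_2<\cdots<n_k$, and let $v(k)$ be the smallest integer greater than $1$ that does not belong to $D_k$ (such an integer exists for every $k \ge 1$). Then there exists an absolute constant $c>0$ such that \[ v(k)\ge e^{ck^2} \] holds for all positive integers $k$. -/

import Mathlib

/-- The set `S_k` of `k`-term unit fraction decompositions of `1`: the strictly increasing
`k`-tuples `(n_1, …, n_k)` of integers `≥ 1` with `1 = 1 / n_1 + ⋯ + 1 / n_k`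
(an equation between rational numbers). -/
def unitFractionDecompositions (k : ℕ) : Set (Fin k → ℕ) :=
  {n | StrictMono n ∧ (∀ i, 1 ≤ n i) ∧ (1 : ℚ) = ∑ i, 1 / (n i : ℚ)}

/-- The set `D_k` of all denominators that occur in at least one `k`-term unit fraction
decomposition of `1`. -/
def unitFractionDenominators (k : ℕ) : Set ℕ :=
  {m | ∃ n ∈ unitFractionDecompositions k, ∃ i, m = n i}

/-- `v(k)`, the smallest integer larger than `1` that does not belong to `D_k`. -/
noncomputable def smallestNonDenominator (k : ℕ) : ℕ :=
  sInf {m : ℕ | 1 < m ∧ m ∉ unitFractionDenominators k}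

open Finset

/-! Put `K = 2 ^ s`. Every `m` with `1 < m < 2 ^ K ^ 2` is a denominator in a decomposition of `1`
with at most `20 * K` terms (`exists_hasUnitSum_one`). Splitting the largest denominator reaches any
larger number of terms, so a number of terms proportional to `K` handles `K ^ 2` binary digits of
`m`.

The source of unit fractions is a number `N` such that every `n` in `[N / 2, N)` is a sum of `O(K)`
distinct divisors `d` of `N`; then `n / (c * N)` is a sum of the fractions `1 / (c * (N / d))`. Take
`N = M * ∏ q` with `K + 2` primes `q ≥ 2 ^ K`, where `M` is `K! * 2 ^ (2 * K)` times `2 * K` odd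
primes up to `K ^ 2`. Mixed radix digits show that `M` is practical with `7 * K` divisors. Each
further prime `q` costs only two divisors of `M`, because `x₁ * y₁ + 2 * x₂ * y₂` meets every
nonzero class modulo `q` when the `xᵢ`, `yᵢ` run over products of two disjoint halves of the small
primes. This follows from the second moment bound `exists_mul_add_mul_eq`, once these products
occupy enough classes modulo `q`, which fails for few primes only (`card_primes_small_image_le`).

Given `m`, choose two more primes `g`, `g'` as markers, with `g` prime to `m`. Fractions with
denominators `2 ^ i` or `3 * 2 ^ i` bring the remainder of `1 - 1 / m` into `[3 / (4 * g), 7 / (8 *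
g)]`. With `G = g' * m` this remainder equals `n / (g * N) + r / (g * G * N)` with `n`, `r` both in
`[N / 2, N)`. Divisibility by `g` and by `g'` keeps the groups of denominators disjoint
(`exists_hasUnitSum_one_of_primes`). -/

/-! ### A bilinear equation over a finite field -/

/-- Over a finite field, a nonzero element is represented by the bilinear form
`x₁ y₁ + x₂ y₂` on large sets. -/
theorem exists_mul_add_mul_eq {F : Type*} [Field F] [Fintype F] [DecidableEq F]
    (X₁ X₂ Y₁ Y₂ : Finset F) (h0 : (0 : F) ∉ Y₁) {r : F} (hr : r ≠ 0)
    (hcard : Fintype.card F ^ 3 < #X₁ * #X₂ * (#Y₁ * #Y₂)) :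
    ∃ x₁ ∈ X₁, ∃ x₂ ∈ X₂, ∃ y₁ ∈ Y₁, ∃ y₂ ∈ Y₂, x₁ * y₁ + x₂ * y₂ = r := by
  by_contra! hno
  set Q := Fintype.card F with hQ
  have hQ0 : 0 < Q := Fintype.card_pos
  let V := X₁ ×ˢ X₂
  let W := Y₁ ×ˢ Y₂
  let E : F × F → F × F → Prop := fun v w => v.1 * w.1 + v.2 * w.2 = r
  let c : F × F → ℕ := fun v => #{w ∈ W | E v w}
  have hw0 : ∀ w ∈ W, w.1 ≠ 0 := by
    intro w hw h
    exact h0 (h ▸ (mem_product.1 hw).1)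
  have hsol : ∀ w ∈ W, #{v : F × F | E v w} = Q := by
    intro w hw
    have h1 := hw0 w hw
    have : ({v : F × F | E v w} : Finset (F × F)) =
        (univ : Finset F).image (fun t => ((r - t * w.2) / w.1, t)) := by
      ext ⟨a, b⟩
      simp only [mem_filter, mem_univ, true_and, mem_image, Prod.mk.injEq, E]
      constructor
      · intro h
        exact ⟨b, by rw [div_eq_iff h1]; linear_combination -h, rfl⟩
      · rintro ⟨t, h, rfl⟩
        rw [div_eq_iff h1] at h
        linear_combination -h
    rw [this, card_image_of_injective, card_univ]
    intro a b hab
    simpa using (Prod.ext_iff.1 hab).2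
  have hpair : ∀ w ∈ W, ∀ w' ∈ W, w ≠ w' → #{v : F × F | E v w ∧ E v w'} ≤ 1 := by
    intro w hw w' hw' hne
    rw [card_le_one]
    rintro ⟨a, b⟩ hv ⟨a', b'⟩ hv'
    simp only [mem_filter, mem_univ, true_and, E] at hv hv'
    obtain ⟨e1, e2⟩ := hv
    obtain ⟨e3, e4⟩ := hv'
    have h1 := hw0 w hw
    -- If the determinant vanished, the two lines would be parallel; a common point and `r ≠ 0` then
    -- force `w = w'`.
    have hdet : w.1 * w'.2 - w.2 * w'.1 ≠ 0 := by
      intro hd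
      have h11 : w.1 = w'.1 := by
        have : r * (w.1 - w'.1) = 0 := by
          linear_combination w'.1 * e1 - w.1 * e2 + b * hd
        rcases mul_eq_zero.1 this with h | h
        · exact absurd h hr
        · exact sub_eq_zero.1 h
      have h22 : w.2 = w'.2 := by
        have : w.1 * (w'.2 - w.2) = 0 := by
          linear_combination hd - w.2 * h11
        rcases mul_eq_zero.1 this with h | h
        · exact absurd h h1
        · exact (sub_eq_zero.1 h).symm
      exact hne (Prod.ext h11 h22)
    have ha : a - a' = 0 := by
      have : (a - a') * (w.1 * w'.2 - w.2 * w'.1) = 0 := by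
        linear_combination w'.2 * (e1 - e3) - w.2 * (e2 - e4)
      exact (mul_eq_zero.1 this).resolve_right hdet
    have hb : b - b' = 0 := by
      have : (b - b') * (w.1 * w'.2 - w.2 * w'.1) = 0 := by
        linear_combination w.1 * (e2 - e4) - w'.1 * (e1 - e3)
      exact (mul_eq_zero.1 this).resolve_right hdet
    exact Prod.ext (sub_eq_zero.1 ha) (sub_eq_zero.1 hb)
  have hsum1 : ∑ v, c v = #W * Q := by
    have : ∑ v, c v = ∑ w ∈ W, #{v : F × F | E v w} := by
      simp only [c, card_filter]
      exact sum_comm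
    rw [this, sum_congr rfl hsol, sum_const, smul_eq_mul]
  have hsum2 : ∑ v, c v ^ 2 ≤ #W * Q + #W ^ 2 := by
    have : ∑ v, c v ^ 2 = ∑ w ∈ W, ∑ w' ∈ W, #{v : F × F | E v w ∧ E v w'} := by
      have : ∀ v, c v ^ 2 = ∑ w ∈ W, ∑ w' ∈ W, if E v w ∧ E v w' then 1 else 0 := by
        intro v
        simp only [c, card_filter, sq, sum_mul_sum]
        refine sum_congr rfl fun w _ => sum_congr rfl fun w' _ => ?_
        by_cases h : E v w <;> by_cases h' : E v w' <;> simp [h, h']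
      simp only [this, card_filter]
      rw [sum_comm]
      refine sum_congr rfl fun w _ => ?_
      rw [sum_comm]
    rw [this]
    calc ∑ w ∈ W, ∑ w' ∈ W, #{v : F × F | E v w ∧ E v w'}
        ≤ ∑ w ∈ W, ∑ w' ∈ W, ((if w = w' then Q else 0) + 1) := by
          refine sum_le_sum fun w hw => sum_le_sum fun w' hw' => ?_
          split_ifs with h
          · subst h
            simp only [and_self]
            rw [hsol w hw]; omega
          · simpa using hpair w hw w' hw' h
      _ = #W * Q + #W ^ 2 := by
          simp only [sum_add_distrib, sum_ite_eq, sum_const, smul_eq_mul, mul_one]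
          rw [sum_congr rfl (fun w hw => if_pos hw)]
          simp [sq]
  have hzero : ∀ v ∈ V, c v = 0 := by
    rintro ⟨a, b⟩ hv
    have hv := mem_product.1 hv
    simp only [c, card_eq_zero, filter_eq_empty_iff]
    rintro ⟨d, e⟩ hw
    have hw := mem_product.1 hw
    exact hno a hv.1 b hv.2 d hw.1 e hw.2
  have hs1 : ∑ v ∈ Vᶜ, c v = #W * Q := by
    rw [← hsum1, ← sum_add_sum_compl V, sum_eq_zero hzero, zero_add]
  have hs2 : ∑ v ∈ Vᶜ, c v ^ 2 ≤ #W * Q + #W ^ 2 :=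
    (sum_le_sum_of_subset (subset_univ _)).trans hsum2
  -- All incidences lie over the complement of `V`. Cauchy–Schwarz there yields `#V * (Q + #W) ≤ Q ^
  -- 3`, against the size hypothesis.
  have hcs := sq_sum_le_card_mul_sum_sq (s := Vᶜ) (f := c)
  rw [hs1] at hcs
  have hV : #Vᶜ + #V = Q ^ 2 := by
    rw [card_compl_add_card, Fintype.card_prod, sq]
  have hWV : Q ^ 3 < #V * #W := by
    simpa [V, W, card_product] using hcard
  have hW0 : 0 < #W := by
    rcases Nat.eq_zero_or_pos (#W) with h | h
    · rw [h] at hWV; simp at hWV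
    · exact h
  have h1 : (#W * Q) ^ 2 ≤ #Vᶜ * (#W * Q + #W ^ 2) := hcs.trans (Nat.mul_le_mul_left _ hs2)
  have h2 : #W * Q ^ 2 ≤ #Vᶜ * (Q + #W) := by
    refine Nat.le_of_mul_le_mul_left ?_ hW0
    calc #W * (#W * Q ^ 2) = (#W * Q) ^ 2 := by ring
      _ ≤ _ := h1
      _ = _ := by ring
  have h3 : #Vᶜ * (Q + #W) + #V * (Q + #W) = Q ^ 2 * (Q + #W) := by rw [← hV]; ring
  nlinarith [Nat.zero_le (#V * Q)]

/-! ### Reduction of sets modulo primes, and subset products -/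

theorem two_pow_card_primeFactors_le {n : ℕ} (hn : n ≠ 0) : 2 ^ #n.primeFactors ≤ n := by
  calc 2 ^ #n.primeFactors = ∏ _p ∈ n.primeFactors, 2 := by simp
    _ ≤ ∏ p ∈ n.primeFactors, p :=
      prod_le_prod' fun p hp => (Nat.prime_of_mem_primeFactors hp).two_le
    _ ≤ n := Nat.le_of_dvd (Nat.pos_of_ne_zero hn) (Nat.prod_primeFactors_dvd n)

theorem card_primes_dvd_le {n H : ℕ} (hn : n ≠ 0) (hH : n < 2 ^ H) (Q : Finset ℕ)
    (hQ : ∀ q ∈ Q, q.Prime) : #{q ∈ Q | q ∣ n} ≤ H := by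
  have h1 : #{q ∈ Q | q ∣ n} ≤ #n.primeFactors := by
    refine card_le_card fun q hq => ?_
    rw [mem_filter] at hq
    exact Nat.mem_primeFactors.2 ⟨hQ q hq.1, hq.2, hn⟩
  have h2 := two_pow_card_primeFactors_le hn
  exact h1.trans (Nat.pow_lt_pow_iff_right (by norm_num) |>.1 (h2.trans_lt hH)).le

/-- A map that has few collisions on `X` has a large image. -/
theorem card_le_card_image_add_card_collisions (X : Finset ℕ) {β : Type*} [DecidableEq β]
    (f : ℕ → β) : #X ≤ #(X.image f) + #{p ∈ X ×ˢ X | p.1 < p.2 ∧ f p.1 = f p.2} := by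
  classical
  induction X using Finset.induction_on_max with
  | empty => simp
  | insert a X ha ih =>
    have haX : a ∉ X := fun h => lt_irrefl _ (ha a h)
    have hsub : {p ∈ X ×ˢ X | p.1 < p.2 ∧ f p.1 = f p.2} ⊆
        {p ∈ insert a X ×ˢ insert a X | p.1 < p.2 ∧ f p.1 = f p.2} := by
      refine filter_subset_filter _ (product_subset_product (subset_insert _ _) (subset_insert _ _))
    rw [card_insert_of_notMem haX, image_insert]
    by_cases hfa : f a ∈ X.image f
    · obtain ⟨b, hb, hba⟩ := mem_image.1 hfa
      have hlt : #{p ∈ X ×ˢ X | p.1 < p.2 ∧ f p.1 = f p.2} <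
          #{p ∈ insert a X ×ˢ insert a X | p.1 < p.2 ∧ f p.1 = f p.2} := by
        refine card_lt_card (Finset.ssubset_iff_subset_ne.2 ⟨hsub, fun h => ?_⟩)
        have : (b, a) ∈ {p ∈ X ×ˢ X | p.1 < p.2 ∧ f p.1 = f p.2} := by
          rw [h]; simp [hb, ha b hb, hba]
        simp [haX] at this
      rw [insert_eq_of_mem hfa]
      omega
    · rw [card_insert_of_notMem hfa]
      have := card_le_card hsub
      omega

/-- All but few primes keep at least half of the elements of `X` apart. -/
theorem card_primes_small_image_le (X Q : Finset ℕ) (H : ℕ) (hX : ∀ x ∈ X, x < 2 ^ H)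
    (hQ : ∀ q ∈ Q, q.Prime) :
    #{q ∈ Q | 2 * #(X.image (Nat.cast : ℕ → ZMod q)) < #X} ≤ 2 * #X * H := by
  rcases X.eq_empty_or_nonempty with rfl | hne
  · simp
  set B := {q ∈ Q | 2 * #(X.image (Nat.cast : ℕ → ZMod q)) < #X} with hB
  let c : ℕ → ℕ := fun q => #{p ∈ X ×ˢ X | p.1 < p.2 ∧ ((p.1 : ZMod q) = (p.2 : ZMod q))}
  have h1 : ∀ q ∈ B, #X ≤ 2 * c q := by
    intro q hq
    have h := card_le_card_image_add_card_collisions X (Nat.cast : ℕ → ZMod q)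
    have h' := (mem_filter.1 hq).2
    simp only [c]
    omega
  -- Double counting: a pair collides only modulo primes dividing its difference, and a positive
  -- number below `2 ^ H` has at most `H` of them.
  have h2 : ∑ q ∈ B, c q ≤ #X * #X * H := by
    simp only [c, card_filter]
    rw [sum_comm, ← card_product, ← smul_eq_mul, ← sum_const]
    refine sum_le_sum fun p hp => ?_
    rw [← card_filter]
    by_cases hlt : p.1 < p.2
    · have hp2 := hX p.2 (mem_product.1 hp).2
      refine le_trans (card_le_card ?_)
        (card_primes_dvd_le (n := p.2 - p.1) (H := H) (by omega) (by omega) Q hQ)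
      intro q hq
      simp only [mem_filter, hB] at hq ⊢
      refine ⟨hq.1.1, ?_⟩
      exact (Nat.modEq_iff_dvd' hlt.le).1 ((ZMod.natCast_eq_natCast_iff _ _ _).1 hq.2.2)
    · simp [hlt]
  have h3 : #B * #X ≤ 2 * (#X * #X * H) := by
    calc #B * #X = ∑ q ∈ B, #X := by simp
      _ ≤ ∑ q ∈ B, 2 * c q := sum_le_sum h1
      _ = 2 * ∑ q ∈ B, c q := by rw [mul_sum]
      _ ≤ _ := Nat.mul_le_mul_left _ h2
  refine Nat.le_of_mul_le_mul_right ?_ hne.card_pos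
  calc #B * #X ≤ 2 * (#X * #X * H) := h3
    _ = _ := by ring

/-- The products of the subsets of `P`. -/
def subsetProducts (P : Finset ℕ) : Finset ℕ := P.powerset.image fun S => ∏ p ∈ S, p

theorem card_subsetProducts {P : Finset ℕ} (hP : ∀ p ∈ P, p.Prime) :
    #(subsetProducts P) = 2 ^ #P := by
  rw [subsetProducts, card_image_of_injOn, card_powerset]
  intro S hS T hT h
  have hS' : ∀ p ∈ S, p.Prime := fun p hp => hP p (mem_powerset.1 hS hp)
  have hT' : ∀ p ∈ T, p.Prime := fun p hp => hP p (mem_powerset.1 hT hp)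
  rw [← Nat.primeFactors_prod hS', ← Nat.primeFactors_prod hT']
  exact congrArg _ h

theorem dvd_prod_of_mem_subsetProducts {P : Finset ℕ} {x : ℕ} (hx : x ∈ subsetProducts P) :
    x ∣ ∏ p ∈ P, p := by
  obtain ⟨S, hS, rfl⟩ := mem_image.1 hx
  exact prod_dvd_prod_of_subset _ _ _ (mem_powerset.1 hS)

/-! ### Practical numbers -/

/-- `n` is a sum of at most `T` distinct divisors of `N`. -/
def IsSumOfDivisors (N T n : ℕ) : Prop :=
  ∃ S : Finset ℕ, S ⊆ N.divisors ∧ #S ≤ T ∧ ∑ d ∈ S, d = n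

theorem isSumOfDivisors_zero (N T : ℕ) : IsSumOfDivisors N T 0 :=
  ⟨∅, by simp, by simp, by simp⟩

theorem isSumOfDivisors_of_dvd {N d : ℕ} (hN : N ≠ 0) (hd : d ∣ N) : IsSumOfDivisors N 1 d :=
  ⟨{d}, by simp [hN, hd], by simp, by simp⟩

theorem IsSumOfDivisors.mul_add {N q T t n r : ℕ} {S : Finset ℕ} (hN : N ≠ 0) (hq : 0 < q)
    (hn : IsSumOfDivisors N T n) (hS : S ⊆ (q * N).divisors) (hSt : #S ≤ t)
    (hSr : ∑ d ∈ S, d = r) (hSq : ∀ d ∈ S, ¬ q ∣ d) :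
    IsSumOfDivisors (q * N) (T + t) (q * n + r) := by
  obtain ⟨S', hS', hT, rfl⟩ := hn
  have hdisj : Disjoint (S'.image (q * ·)) S := by
    rw [Finset.disjoint_left]
    intro x hx hxS
    obtain ⟨d, -, rfl⟩ := mem_image.1 hx
    exact hSq _ hxS (dvd_mul_right _ _)
  refine ⟨S'.image (q * ·) ∪ S, union_subset ?_ hS, ?_, ?_⟩
  · intro x hx
    obtain ⟨d, hd, rfl⟩ := mem_image.1 hx
    rw [Nat.mem_divisors]
    exact ⟨Nat.mul_dvd_mul_left q (Nat.dvd_of_mem_divisors (hS' hd)), by positivity⟩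
  · exact (card_union_le _ _).trans (Nat.add_le_add (card_image_le.trans hT) hSt)
  · rw [sum_union hdisj, hSr, sum_image (fun a _ b _ h => Nat.eq_of_mul_eq_mul_left hq h), mul_sum]

/-- Every natural number less than `N` is a sum of at most `T` distinct divisors of `N`. -/
def IsPractical (N T : ℕ) : Prop := ∀ n < N, IsSumOfDivisors N T n

/-- Euclidean division by `b`: the divisors representing the quotient become multiples of `b`, while
those representing the remainder are positive and below `b`, so no divisor is used twice. -/
theorem IsPractical.mul {N T b t : ℕ} (hN : N ≠ 0) (h : IsPractical N T)
    (hb : ∀ r < b, IsSumOfDivisors (b * N) t r) : IsPractical (b * N) (T + t) := by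
  intro n hn
  have hb0 : 0 < b := Nat.pos_of_ne_zero (by rintro rfl; simp at hn)
  obtain ⟨S, hS, hSt, hSr⟩ := hb (n % b) (Nat.mod_lt _ hb0)
  have := (h (n / b) (Nat.div_lt_of_lt_mul hn)).mul_add hN hb0 hS hSt hSr ?_
  · rwa [Nat.div_add_mod] at this
  · intro d hd hbd
    have h1 : d ≤ n % b := hSr ▸ single_le_sum (f := fun d => d) (fun _ _ => Nat.zero_le _) hd
    have h2 := Nat.mod_lt n hb0
    have h3 := Nat.pos_of_mem_divisors (hS hd)
    exact absurd (Nat.le_of_dvd h3 hbd) (by omega)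

theorem isPractical_two_pow (a : ℕ) : IsPractical (2 ^ a) a := by
  induction a with
  | zero =>
    intro n hn
    obtain rfl : n = 0 := by simpa using hn
    exact isSumOfDivisors_zero _ _
  | succ a ih =>
    rw [pow_succ']
    refine ih.mul (by positivity) fun r hr => ?_
    interval_cases r
    · exact isSumOfDivisors_zero _ _
    · exact isSumOfDivisors_of_dvd (by positivity) (one_dvd _)

theorem IsPractical.factorial_mul {N T : ℕ} (hN : N ≠ 0) (h : IsPractical N T) (j : ℕ) :
    IsPractical (j.factorial * N) (T + j) := by
  induction j with
  | zero => simpa using h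
  | succ j ih =>
    rw [Nat.factorial_succ, mul_assoc, ← add_assoc]
    refine ih.mul (mul_ne_zero (Nat.factorial_ne_zero _) hN) fun r hr => ?_
    rcases Nat.eq_zero_or_pos r with rfl | hr0
    · exact isSumOfDivisors_zero _ _
    · refine isSumOfDivisors_of_dvd ?_ ?_
      · have := Nat.factorial_ne_zero j
        positivity
      · exact ((Nat.dvd_factorial hr0 (Nat.lt_succ_iff.1 hr)).mul_right N).mul_left _

theorem isSumOfDivisors_two_digits {N b r : ℕ} (hN : N ≠ 0)
    (h1 : ∀ j, 0 < j → j < b → j ∣ N) (h2 : ∀ j, 0 < j → j < b → b * j ∣ N) (hr : r < b * b) :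
    IsSumOfDivisors N 2 r := by
  have hb : 0 < b := Nat.pos_of_ne_zero (by rintro rfl; simp at hr)
  have hmod := Nat.mod_lt r hb
  have hdiv : r / b < b := Nat.div_lt_of_lt_mul hr
  have hr' := Nat.div_add_mod r b
  -- A zero digit contributes no divisor, hence the `erase 0`; the two entries coincide only when
  -- both are zero.
  refine ⟨({b * (r / b), r % b} : Finset ℕ).erase 0, ?_, ?_, ?_⟩
  · intro d hd
    simp only [mem_erase, mem_insert, mem_singleton] at hd
    rw [Nat.mem_divisors]
    refine ⟨?_, hN⟩
    rcases hd with ⟨h0, rfl | rfl⟩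
    · exact h2 _ (Nat.pos_of_ne_zero (right_ne_zero_of_mul h0)) hdiv
    · exact h1 _ (Nat.pos_of_ne_zero h0) hmod
  · exact (card_erase_le).trans card_le_two
  · rw [sum_erase (f := fun d : ℕ => d) _ rfl]
    by_cases h : b * (r / b) = r % b
    · have : r / b = 0 := by
        by_contra h0
        have := Nat.le_mul_of_pos_right b (Nat.pos_of_ne_zero h0)
        omega
      rw [this] at h hr'
      simp only [this, mul_zero, ← h, pair_eq_singleton, sum_singleton]
      omega
    · rw [sum_pair h, hr']

/-- A digit below `p ≤ b * b` has two digits in base `b`, so each new factor costs two divisors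
although it may be as large as `b * b`. -/
theorem IsPractical.prod_mul {N T b : ℕ} (hN : N ≠ 0) (h : IsPractical N T)
    (h1 : ∀ j, 0 < j → j < b → j ∣ N) (h2 : ∀ j, 0 < j → j < b → b * j ∣ N) (P : Finset ℕ)
    (hP : ∀ p ∈ P, 0 < p ∧ p ≤ b * b) : IsPractical ((∏ p ∈ P, p) * N) (T + 2 * #P) := by
  induction P using Finset.induction_on with
  | empty => simpa using h
  | insert p P hp ih =>
    rw [prod_insert hp, card_insert_of_notMem hp, mul_assoc, mul_add, ← add_assoc]
    have hPP : ∀ p ∈ P, 0 < p ∧ p ≤ b * b := fun x hx => hP x (mem_insert_of_mem hx)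
    have h0 : (∏ p ∈ P, p) * N ≠ 0 :=
      mul_ne_zero (prod_ne_zero_iff.2 fun x hx => (hPP x hx).1.ne') hN
    have hp' := hP p (mem_insert_self _ _)
    refine (ih hPP).mul h0 fun r hr => ?_
    exact isSumOfDivisors_two_digits (b := b) (mul_ne_zero hp'.1.ne' h0)
      (fun j hj hjb => ((h1 j hj hjb).mul_left _).mul_left _)
      (fun j hj hjb => ((h2 j hj hjb).mul_left _).mul_left _) (hr.trans_le hp'.2)

/-! ### Large prime factors at two divisors each -/

/-- Every residue class modulo `q` contains a sum of at most two distinct divisors of `M`. -/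
def DivisorsCover (M q : ℕ) : Prop :=
  ∀ n, ∃ S : Finset ℕ, S ⊆ M.divisors ∧ #S ≤ 2 ∧ ∑ d ∈ S, d ≡ n [MOD q]

/-- Every `n < N` that is not much smaller than `N / 2` is a sum of at most `T` distinct
divisors of `N`; the permitted defect is measured by `M`. -/
def IsUpperPractical (M N T : ℕ) : Prop :=
  ∀ n < N, N ≤ 2 * n + 8 * M → IsSumOfDivisors N T n

theorem IsUpperPractical.mul {M N T q : ℕ} (hN : N ≠ 0) (hMN : M ∣ N) (hq : 16 ≤ q)
    (hcov : DivisorsCover M q) (h : IsUpperPractical M N T)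
    (hqd : ∀ d, d ∣ M → ¬ q ∣ d) :
    IsUpperPractical M (q * N) (T + 2) := by
  intro n hn hn'
  obtain ⟨S, hS, hS2, hmod⟩ := hcov n
  have hMle : M ≤ N := Nat.le_of_dvd (Nat.pos_of_ne_zero hN) hMN
  -- The bound `16 ≤ q` gives `n ≥ 4 * M`, so subtracting at most `2 * M` is legitimate. The defect
  -- grows to `12 * M` and falls below `8 * M` again after division by `q`.
  have hsum : ∑ d ∈ S, d ≤ 2 * M := by
    calc ∑ d ∈ S, d ≤ ∑ d ∈ S, M := sum_le_sum fun d hd => Nat.divisor_le (hS hd)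
      _ = #S * M := by simp
      _ ≤ 2 * M := Nat.mul_le_mul_right _ hS2
  have h16 : 16 * N ≤ q * N := Nat.mul_le_mul_right _ hq
  have hle : ∑ d ∈ S, d ≤ n := by omega
  obtain ⟨n', hn''⟩ := (Nat.modEq_iff_dvd' hle).1 hmod
  have hdecomp : n = q * n' + ∑ d ∈ S, d := by omega
  rw [hdecomp]
  refine IsSumOfDivisors.mul_add hN (by omega) (h n' ?_ ?_) ?_ hS2 rfl ?_
  · have : q * n' < q * N := by omega
    exact Nat.lt_of_mul_lt_mul_left this
  · have h1 : q * N ≤ q * (2 * n') + 12 * M := by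
      have : q * (2 * n') = 2 * (q * n') := by ring
      omega
    have h2 : 12 * M ≤ q * (8 * M) := by nlinarith [Nat.zero_le M]
    refine Nat.le_of_mul_le_mul_left (c := q) ?_ (by omega)
    rw [mul_add]; omega
  · intro d hd
    rw [Nat.mem_divisors]
    exact ⟨((Nat.dvd_of_mem_divisors (hS hd)).trans hMN).mul_left _, mul_ne_zero (by omega) hN⟩
  · exact fun d hd => hqd d (Nat.dvd_of_mem_divisors (hS hd))

theorem isUpperPractical_prod_mul {M T : ℕ} (hM : M ≠ 0) (h : IsPractical M T) (R : Finset ℕ)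
    (hR : ∀ q ∈ R, 16 ≤ q ∧ ¬ q ∣ M ∧ DivisorsCover M q) :
    IsUpperPractical M ((∏ q ∈ R, q) * M) (T + 2 * #R) := by
  induction R using Finset.induction_on with
  | empty => intro n hn _; simpa using h n (by simpa using hn)
  | insert q R hq ih =>
    rw [prod_insert hq, card_insert_of_notMem hq, mul_assoc, mul_add, ← add_assoc]
    have hRR := fun x hx => hR x (mem_insert_of_mem (a := x) (b := q) hx)
    obtain ⟨h1, h2, h3⟩ := hR q (mem_insert_self _ _)
    refine (ih hRR).mul (mul_ne_zero (prod_ne_zero_iff.2 fun x hx => ?_) hM) (dvd_mul_left _ _)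
      h1 h3 fun d hd hqd => h2 (hqd.trans hd)
    have := (hRR x hx).1
    omega

/-- Products of elements of `X` and `Y` provide pairs of divisors in all residue classes. -/
theorem divisorsCover_of_card {M q : ℕ} (hM : M ≠ 0) (hq : q.Prime) (hq2 : q ≠ 2) (X Y : Finset ℕ)
    (hX : ∀ x ∈ X, Odd x) (hY : ∀ y ∈ Y, Odd y ∧ ¬ q ∣ y)
    (hXY : ∀ x ∈ X, ∀ y ∈ Y, 2 * (x * y) ∣ M)
    (hcard : q ^ 3 < (#(X.image (Nat.cast : ℕ → ZMod q)) * #(Y.image (Nat.cast : ℕ → ZMod q))) ^ 2) :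
    DivisorsCover M q := by
  have := Fact.mk hq
  intro n
  by_cases hn : (n : ZMod q) = 0
  · exact ⟨∅, by simp, by simp, ((ZMod.natCast_eq_natCast_iff _ _ _).1 (by simpa using hn.symm))⟩
  have h2 : (2 : ZMod q) ≠ 0 := by
    have : ¬ q ∣ 2 := fun h => hq2 ((Nat.prime_dvd_prime_iff_eq hq Nat.prime_two).1 h)
    rw [← ZMod.natCast_eq_zero_iff] at this
    simpa using this
  set X' := X.image (Nat.cast : ℕ → ZMod q)
  set Y' := Y.image (Nat.cast : ℕ → ZMod q)
  -- The second copy of `X'` is doubled so that one divisor is odd and the other even, hence they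
  -- differ.
  have hX2 : #(X'.image (2 * ·)) = #X' := card_image_of_injective _ (mul_right_injective₀ h2)
  obtain ⟨x₁, hx₁, x₂, hx₂, y₁, hy₁, y₂, hy₂, hsum⟩ :=
    exists_mul_add_mul_eq X' (X'.image (2 * ·)) Y' Y' (r := (n : ZMod q)) (by
      intro h
      obtain ⟨y, hy, hy0⟩ := mem_image.1 h
      exact (hY y hy).2 ((ZMod.natCast_eq_zero_iff _ _).1 hy0)) hn (by
      rw [hX2, ZMod.card]
      calc q ^ 3 < _ := hcard
        _ = _ := by ring)
  obtain ⟨x₁, mx₁, rfl⟩ := mem_image.1 hx₁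
  obtain ⟨x₂', hx₂', rfl⟩ := mem_image.1 hx₂
  obtain ⟨x₂, mx₂, rfl⟩ := mem_image.1 hx₂'
  obtain ⟨y₁, my₁, rfl⟩ := mem_image.1 hy₁
  obtain ⟨y₂, my₂, rfl⟩ := mem_image.1 hy₂
  have hne : x₁ * y₁ ≠ 2 * (x₂ * y₂) := by
    intro h
    have h1 : Odd (x₁ * y₁) := (hX _ mx₁).mul (hY _ my₁).1
    rw [h] at h1
    exact Nat.not_odd_iff_even.2 (even_two_mul _) h1
  refine ⟨{x₁ * y₁, 2 * (x₂ * y₂)}, ?_, card_le_two, ?_⟩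
  · intro d hd
    rw [mem_insert, mem_singleton] at hd
    rw [Nat.mem_divisors]
    refine ⟨?_, hM⟩
    rcases hd with rfl | rfl
    · exact (dvd_mul_left _ _).trans (hXY _ mx₁ _ my₁)
    · exact hXY _ mx₂ _ my₂
  · rw [sum_pair hne, ← ZMod.natCast_eq_natCast_iff, ← hsum]
    push_cast
    ring

/-! ### Sums of distinct unit fractions -/

/-- The finite set `S` of positive integers is the set of denominators of a sum of distinct unit
fractions with value `x`. -/
def HasUnitSum (S : Finset ℕ) (x : ℚ) : Prop := 0 ∉ S ∧ ∑ n ∈ S, (1 / (n : ℚ)) = x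

theorem HasUnitSum.union {S T : Finset ℕ} {x y : ℚ} (hS : HasUnitSum S x) (hT : HasUnitSum T y)
    (h : Disjoint S T) : HasUnitSum (S ∪ T) (x + y) :=
  ⟨by simp [hS.1, hT.1], by rw [sum_union h, hS.2, hT.2]⟩

theorem hasUnitSum_singleton {m : ℕ} (hm : m ≠ 0) : HasUnitSum {m} (1 / m) :=
  ⟨by simpa using hm.symm, by simp⟩

/-- Uses `d / (c * N) = 1 / (c * (N / d))`. The factor `c` marks all the denominators and later
separates them from other groups. -/
theorem IsSumOfDivisors.exists_hasUnitSum {N T n c : ℕ} (hN : N ≠ 0) (hc : c ≠ 0)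
    (h : IsSumOfDivisors N T n) :
    ∃ E : Finset ℕ, #E ≤ T ∧ (∀ e ∈ E, c ∣ e ∧ e ∣ c * N) ∧ HasUnitSum E (n / (c * N)) := by
  obtain ⟨S, hS, hT, rfl⟩ := h
  have hd : ∀ d ∈ S, d ∣ N := fun d h => Nat.dvd_of_mem_divisors (hS h)
  refine ⟨S.image fun d => c * (N / d), card_image_le.trans hT, ?_, ?_, ?_⟩
  · intro e he
    obtain ⟨d, hdS, rfl⟩ := mem_image.1 he
    exact ⟨dvd_mul_right _ _, Nat.mul_dvd_mul_left _ (Nat.div_dvd_of_dvd (hd d hdS))⟩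
  · intro h0
    obtain ⟨d, hdS, h0⟩ := mem_image.1 h0
    rcases mul_eq_zero.1 h0 with h | h
    · exact hc h
    · have := Nat.div_mul_cancel (hd d hdS)
      rw [h] at this
      simp at this
      exact hN this.symm
  · rw [sum_image]
    · push_cast
      rw [sum_div]
      refine sum_congr rfl fun d hdS => ?_
      have hd0 : (d : ℚ) ≠ 0 := by
        have := Nat.pos_of_mem_divisors (hS hdS)
        positivity
      have hN' : (N : ℚ) ≠ 0 := by exact_mod_cast hN
      have hc' : (c : ℚ) ≠ 0 := by exact_mod_cast hc
      rw [Nat.cast_div (hd d hdS) hd0]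
      field_simp
    · intro a ha b hb hab
      have h1 : N / a = N / b := Nat.eq_of_mul_eq_mul_left (Nat.pos_of_ne_zero hc) hab
      have h2 := Nat.div_mul_cancel (hd a ha)
      have h3 := Nat.div_mul_cancel (hd b hb)
      rw [h1] at h2
      have h4 : 0 < N / b := Nat.pos_of_ne_zero (by rintro h; rw [h] at h3; simp at h3; exact hN h3.symm)
      exact Nat.eq_of_mul_eq_mul_left h4 (h2.trans h3.symm)

/-- A decomposition with a denominator larger than `m` can be lengthened by splitting its largest
denominator. -/
theorem exists_hasUnitSum_card_eq {m : ℕ} (hm : 1 ≤ m) {x : ℚ} (k : ℕ) (S : Finset ℕ) (hmS : m ∈ S)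
    (hlarge : ∃ e ∈ S, m < e) (hS : HasUnitSum S x) (hk : #S ≤ k) :
    ∃ S' : Finset ℕ, m ∈ S' ∧ HasUnitSum S' x ∧ #S' = k := by
  induction k with
  | zero =>
    rw [Nat.le_zero, card_eq_zero] at hk
    simp [hk] at hmS
  | succ k ih =>
    rcases Nat.lt_or_ge k (#S) with hlt | hge
    · exact ⟨S, hmS, hS, by omega⟩
    suffices H : ∀ k, ∃ S' : Finset ℕ, m ∈ S' ∧ HasUnitSum S' x ∧ #S' = #S + k ∧ ∃ e ∈ S', m < e by
      obtain ⟨S', h1, h2, h3, -⟩ := H (k + 1 - #S)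
      exact ⟨S', h1, h2, by omega⟩
    intro j
    induction j with
    | zero => exact ⟨S, hmS, hS, rfl, hlarge⟩
    | succ j ihj =>
      obtain ⟨A, hmA, hA, hcard, e, heA, hme⟩ := ihj
      have hne : A.Nonempty := ⟨m, hmA⟩
      -- The maximum exceeds `m`, so splitting it keeps `m`; the new denominators lie above all the
      -- old ones.
      set M := A.max' hne with hM
      have hMA : M ∈ A := A.max'_mem hne
      have hmax : ∀ a ∈ A, a ≤ M := fun a ha => A.le_max' a ha
      have hmM : m < M := hme.trans_le (hmax e heA)
      have hM1 : M + 1 < M * (M + 1) := by nlinarith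
      have hd1 : Disjoint (A.erase M) {M + 1, M * (M + 1)} := by
        rw [Finset.disjoint_left]
        intro a ha hb
        have := hmax a (mem_of_mem_erase ha)
        simp only [mem_insert, mem_singleton] at hb
        omega
      have hpair : #({M + 1, M * (M + 1)} : Finset ℕ) = 2 := card_pair hM1.ne
      refine ⟨A.erase M ∪ {M + 1, M * (M + 1)}, ?_, ⟨?_, ?_⟩, ?_, M + 1, by simp, by omega⟩
      · exact mem_union_left _ (mem_erase.2 ⟨hmM.ne, hmA⟩)
      · have h0 := hA.1
        simp only [mem_union, mem_erase, mem_insert, mem_singleton, not_or, not_and]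
        exact ⟨fun _ => h0, by omega, by omega⟩
      · rw [sum_union hd1, sum_pair hM1.ne, ← hA.2, ← sum_erase_add A _ hMA]
        congr 1
        have : (M : ℚ) ≠ 0 := by
          have : 0 < M := by omega
          positivity
        have h' : (M : ℚ) + 1 ≠ 0 := by positivity
        push_cast
        field_simp
      · rw [card_union_of_disjoint hd1, hpair, card_erase_of_mem hMA]
        have := card_pos.2 hne
        omega

theorem mem_unitFractionDenominators {m k : ℕ} {S : Finset ℕ} (hmS : m ∈ S) (hS : HasUnitSum S 1)
    (hk : #S = k) : m ∈ unitFractionDenominators k := by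
  have hr := Finset.range_orderEmbOfFin S hk
  refine ⟨S.orderEmbOfFin hk, ⟨(S.orderEmbOfFin hk).strictMono, fun i => ?_, ?_⟩, ?_⟩
  · have := S.orderEmbOfFin_mem hk i
    exact Nat.one_le_iff_ne_zero.2 fun h => hS.1 (h ▸ this)
  · have : S = univ.map (S.orderEmbOfFin hk).toEmbedding := by
      simp
    have h1 := hS.2
    rw [this, sum_map] at h1
    exact h1.symm
  · have : m ∈ Set.range (S.orderEmbOfFin hk) := by rw [hr]; exact hmS
    obtain ⟨i, hi⟩ := this
    exact ⟨i, hi.symm⟩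

/-- The denominators in the representations of `x` by `k` unit fractions are bounded. -/
theorem exists_forall_hasUnitSum_le (k : ℕ) (x : ℚ) :
    ∃ B, ∀ S : Finset ℕ, HasUnitSum S x → #S = k → ∀ n ∈ S, n ≤ B := by
  induction k generalizing x with
  | zero =>
    refine ⟨0, fun S _ hS n hn => ?_⟩
    rw [card_eq_zero] at hS
    simp [hS] at hn
  | succ k ih =>
    choose B hB using ih
    -- The least of `k + 1` denominators is at most `(k + 1) / x`; removing it leaves one of
    -- finitely many remainders.
    let C := ⌈(k + 1 : ℚ) / x⌉₊
    refine ⟨C + ∑ j ∈ range (C + 1), B (x - 1 / j), fun S hS hcard n hn => ?_⟩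
    have hne : S.Nonempty := ⟨n, hn⟩
    set a := S.min' hne
    have haS : a ∈ S := S.min'_mem hne
    have ha0 : 0 < a := Nat.pos_of_ne_zero fun h => hS.1 (h ▸ haS)
    have haq : (0 : ℚ) < a := by exact_mod_cast ha0
    have hx : 0 < x := by
      rw [← hS.2]
      refine sum_pos (fun i hi => ?_) hne
      have : 0 < i := Nat.pos_of_ne_zero fun h => hS.1 (h ▸ hi)
      positivity
    have hle : x ≤ (k + 1) / a := by
      rw [← hS.2]
      calc ∑ n ∈ S, 1 / (n : ℚ) ≤ ∑ n ∈ S, 1 / (a : ℚ) := by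
            refine sum_le_sum fun i hi => ?_
            have : (a : ℚ) ≤ i := by exact_mod_cast S.min'_le i hi
            exact one_div_le_one_div_of_le haq this
        _ = (k + 1) / a := by
            rw [sum_const, hcard, nsmul_eq_mul]
            push_cast
            ring
    have haC : a ≤ C := by
      have h1 : (a : ℚ) ≤ (k + 1) / x := by
        rw [le_div_iff₀ hx]
        rw [le_div_iff₀ haq] at hle
        linarith
      have h2 := h1.trans (Nat.le_ceil _)
      exact Nat.cast_le.1 h2
    by_cases hna : n = a
    · omega
    · have h1 : HasUnitSum (S.erase a) (x - 1 / a) := by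
        refine ⟨fun h => hS.1 (mem_of_mem_erase h), ?_⟩
        rw [← hS.2, ← sum_erase_add S _ haS]
        ring
      have h2 := hB (x - 1 / a) (S.erase a) h1 (by rw [card_erase_of_mem haS, hcard]; rfl) n
        (mem_erase.2 ⟨hna, hn⟩)
      have h3 : B (x - 1 / a) ≤ ∑ j ∈ range (C + 1), B (x - 1 / j) :=
        single_le_sum (f := fun j : ℕ => B (x - 1 / j)) (fun _ _ => Nat.zero_le _)
          (mem_range.2 (by omega))
      omega

/-- Boundedness of the denominators makes the set nonempty, so the `sInf` is a true minimum and not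
the default value `0`. -/
theorem isLeast_smallestNonDenominator (k : ℕ) :
    IsLeast {m : ℕ | 1 < m ∧ m ∉ unitFractionDenominators k} (smallestNonDenominator k) := by
  obtain ⟨B, hB⟩ := exists_forall_hasUnitSum_le k 1
  have hne : {m : ℕ | 1 < m ∧ m ∉ unitFractionDenominators k}.Nonempty := by
    refine ⟨B + 2, by omega, ?_⟩
    rintro ⟨n, ⟨hmono, hpos, hsum⟩, i, hi⟩
    have h := hB (univ.image n) ⟨?_, ?_⟩ ?_ (n i) (mem_image_of_mem _ (mem_univ _))
    · omega
    · intro h0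
      obtain ⟨j, -, hj⟩ := mem_image.1 h0
      have := hpos j
      omega
    · rw [sum_image (fun a _ b _ h => hmono.injective h)]
      exact hsum.symm
    · rw [card_image_of_injective _ hmono.injective, card_univ, Fintype.card_fin]
  exact ⟨Nat.sInf_mem hne, fun m hm => Nat.sInf_le hm⟩

/-! ### Approximation from below by dyadic unit fractions -/

/-- Round `y * (h * 2 ^ L)` down to an integer: a binary digit `2 ^ i` of it contributes the unit
fraction with denominator `h * 2 ^ (L - i)`. -/
theorem exists_hasUnitSum_near_of_lt {h L : ℕ} (hh : 0 < h) {y : ℚ} (hy0 : 0 ≤ y)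
    (hy : y * (h * 2 ^ L) < 2 ^ (L + 1)) :
    ∃ S : Finset ℕ, #S ≤ L + 1 ∧ (∀ n ∈ S, ∃ j ≤ L, n = h * 2 ^ j) ∧
      ∃ z, HasUnitSum S z ∧ z ≤ y ∧ (y - z) * (h * 2 ^ L) < 1 := by
  set a := ⌊y * (h * 2 ^ L)⌋₊ with ha
  have hpos : 0 ≤ y * (h * 2 ^ L) := by positivity
  have ha1 : (a : ℚ) ≤ y * (h * 2 ^ L) := Nat.floor_le hpos
  have ha2 : y * (h * 2 ^ L) < a + 1 := Nat.lt_floor_add_one _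
  have ha3 : a < 2 ^ (L + 1) := by exact_mod_cast ha1.trans_lt hy
  have hsum := sum_toFinset_bitIndices_two_pow a
  set I := a.bitIndices.toFinset
  have hI : ∀ i ∈ I, i ≤ L := by
    intro i hi
    have h1 : 2 ^ i ≤ a := by
      rw [← hsum]
      exact single_le_sum (f := fun i => 2 ^ i) (fun _ _ => Nat.zero_le _) hi
    have := (Nat.pow_lt_pow_iff_right (a := 2) (by norm_num)).1 (h1.trans_lt ha3)
    omega
  have hh' : (0 : ℚ) < h := by exact_mod_cast hh
  refine ⟨I.image fun i => h * 2 ^ (L - i), ?_, ?_, a / (h * 2 ^ L), ⟨?_, ?_⟩, ?_, ?_⟩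
  · refine card_image_le.trans ((card_le_card fun i hi => ?_).trans (card_range (L + 1)).le)
    exact mem_range.2 (Nat.lt_succ_of_le (hI i hi))
  · intro n hn
    obtain ⟨i, -, rfl⟩ := mem_image.1 hn
    exact ⟨L - i, Nat.sub_le _ _, rfl⟩
  · intro h0
    obtain ⟨i, -, hi⟩ := mem_image.1 h0
    have : 0 < h * 2 ^ (L - i) := by positivity
    omega
  · rw [sum_image]
    · conv_rhs => rw [← hsum]
      push_cast
      rw [sum_div]
      refine sum_congr rfl fun i hi => ?_
      have h2 : (2 : ℚ) ^ L = 2 ^ (L - i) * 2 ^ i := by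
        rw [← pow_add, Nat.sub_add_cancel (hI i hi)]
      rw [h2]
      field_simp
    · intro i hi j hj hij
      have h1 := Nat.pow_right_injective (le_refl 2) (Nat.eq_of_mul_eq_mul_left hh hij)
      have := hI i hi
      have := hI j hj
      omega
  · rw [div_le_iff₀ (by positivity)]
    exact ha1
  · rw [sub_mul, div_mul_cancel₀ _ (by positivity)]
    linarith

/-- `y` close to `1 - 1 / m` is approximated from below by unit fractions with denominators
`2 ^ i` or `3 * 2 ^ i` different from `m`. -/
theorem exists_hasUnitSum_near {m L : ℕ} (hm : 1 < m) {y : ℚ} (hy0 : 0 ≤ y)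
    (hy : y < 1 - 1 / m) :
    ∃ S : Finset ℕ, #S ≤ L + 2 ∧ (∀ n ∈ S, n ∣ 3 * 2 ^ (L + 1)) ∧ m ∉ S ∧
      ∃ z, HasUnitSum S z ∧ z ≤ y ∧ (y - z) * 2 ^ L < 1 := by
  have hm0 : (0 : ℚ) < m := by positivity
  have hm1 : (2 : ℚ) ≤ m := by exact_mod_cast hm
  have hpow : (1 : ℚ) ≤ 2 ^ L := one_le_pow₀ (by norm_num)
  have hminv : (1 : ℚ) / m ≤ 1 / 2 := one_div_le_one_div_of_le (by norm_num) hm1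
  have hminv0 : (0 : ℚ) < 1 / m := by positivity
  by_cases h2 : ∃ i, m = 2 ^ i
  · obtain ⟨i, hi⟩ := h2
    have hne : ∀ j, m ≠ 3 * 2 ^ j := by
      intro j hj
      have : 3 ∣ 2 ^ i := hi ▸ hj ▸ dvd_mul_right _ _
      have := Nat.prime_three.dvd_of_dvd_pow this
      omega
    -- For `m` a power of two the denominators `3 * 2 ^ j` avoid `m`, but they reach only values
    -- below `2 / 3`. For larger `y` the term `1 / 2` is split off first; there `m ≠ 2`, since `y <
    -- 1 - 1 / m`.
    have aux : ∀ y' : ℚ, 0 ≤ y' → y' < 2 / 3 → ∃ S : Finset ℕ, #S ≤ L + 1 ∧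
        (∀ n ∈ S, n ∣ 3 * 2 ^ (L + 1)) ∧ (m ∉ S ∧ 2 ∉ S) ∧
        ∃ z, HasUnitSum S z ∧ z ≤ y' ∧ (y' - z) * 2 ^ L < 1 := by
      intro y' h0 h1
      obtain ⟨S, hS1, hS2, z, hz, hzy, hz'⟩ :=
        exists_hasUnitSum_near_of_lt (h := 3) (L := L) (by norm_num) h0 (by
          rw [pow_succ]; push_cast; nlinarith)
      refine ⟨S, hS1, ?_, ⟨?_, ?_⟩, z, hz, hzy, ?_⟩
      · intro n hn
        obtain ⟨j, hj, rfl⟩ := hS2 n hn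
        exact Nat.mul_dvd_mul_left _ (pow_dvd_pow _ (by omega))
      · intro hmS
        obtain ⟨j, -, hj⟩ := hS2 m hmS
        exact hne j hj
      · intro hmS
        obtain ⟨j, -, hj⟩ := hS2 2 hmS
        omega
      · push_cast at hz'
        nlinarith [mul_nonneg (sub_nonneg.2 hzy) (zero_le_one.trans hpow)]
    rcases lt_or_ge y (2 / 3) with h | h
    · obtain ⟨S, h1, h3, h4, h5⟩ := aux y hy0 h
      exact ⟨S, h1.trans (by omega), h3, h4.1, h5⟩
    · obtain ⟨S, h1, h3, h4, z, hz, hzy, hz'⟩ := aux (y - 1 / 2) (by linarith) (by linarith)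
      have hm2 : m ≠ 2 := by
        rintro rfl
        norm_num at hy
        linarith
      refine ⟨S ∪ {2}, ?_, ?_, ?_, z + 1 / 2, ?_, by linarith, ?_⟩
      · exact (card_union_le _ _).trans (by simpa using h1)
      · intro n hn
        rcases mem_union.1 hn with hn | hn
        · exact h3 n hn
        · rw [mem_singleton.1 hn, pow_succ]
          exact (dvd_mul_left _ _).mul_left _
      · simp [h4.1, hm2]
      · exact hz.union (by simpa using hasUnitSum_singleton (m := 2) (by norm_num))
          (disjoint_singleton_right.2 h4.2)
      · rw [← sub_sub, sub_right_comm]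
        exact hz'
  · push Not at h2
    obtain ⟨S, hS1, hS2, z, hz, hzy, hz'⟩ :=
      exists_hasUnitSum_near_of_lt (h := 2) (L := L) (y := y) (by norm_num) hy0 (by
        rw [pow_succ]; push_cast; nlinarith)
    refine ⟨S, hS1.trans (by omega), ?_, ?_, z, hz, hzy, ?_⟩
    · intro n hn
      obtain ⟨j, hj, rfl⟩ := hS2 n hn
      rw [← pow_succ']
      exact (pow_dvd_pow _ (by omega)).mul_left _
    · intro hmS
      obtain ⟨j, -, hj⟩ := hS2 m hmS
      rw [← pow_succ'] at hj
      exact h2 _ hj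
    · push_cast at hz'
      nlinarith [mul_nonneg (sub_nonneg.2 hzy) (zero_le_one.trans hpow)]

/-! ### The decomposition of `1` through `m` -/

/-- Given enough auxiliary primes `R`, `g`, `g'` prime to `m`, the integer `m` is a denominator in
a decomposition of `1` with few terms. -/
theorem exists_hasUnitSum_one_of_primes {M T m L g g' : ℕ} {R : Finset ℕ} (hM : M ≠ 0)
    (hprac : IsPractical M T) (hm : 1 < m)
    (hR : ∀ q ∈ R, q.Prime ∧ 16 ≤ q ∧ ¬ q ∣ M ∧ DivisorsCover M q)
    (hg : g.Prime) (hg' : g'.Prime) (hgg' : g ≠ g') (hgR : g ∉ R) (hgR' : g' ∉ R)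
    (hgm : ¬ g ∣ m) (hgM : ¬ g ∣ M) (hgM' : ¬ g' ∣ M)
    (hL : 3 * 2 ^ (L + 1) ∣ M) (hgL : 8 * g ≤ 2 ^ L) (hN : 2 * (g' * m) ≤ ∏ q ∈ R, q) :
    ∃ S : Finset ℕ, m ∈ S ∧ (∃ e ∈ S, m < e) ∧ HasUnitSum S 1 ∧
      #S ≤ 1 + (L + 2) + 2 * (T + 2 * #R) := by
  have hupper := isUpperPractical_prod_mul hM hprac R fun q hq => (hR q hq).2
  set N := (∏ q ∈ R, q) * M with hNdef
  have hprod0 : ∏ q ∈ R, q ≠ 0 := prod_ne_zero_iff.2 fun q hq => (hR q hq).1.ne_zero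
  have hN0 : N ≠ 0 := mul_ne_zero hprod0 hM
  have hnot : ∀ p : ℕ, p.Prime → p ∉ R → ¬ p ∣ M → ¬ p ∣ N := by
    intro p hp hpR hpM h
    rcases hp.dvd_mul.1 h with h | h
    · obtain ⟨q, hq, hpq⟩ := (hp.prime.dvd_finsetProd_iff _).1 h
      exact hpR ((Nat.prime_dvd_prime_iff_eq hp (hR q hq).1).1 hpq ▸ hq)
    · exact hpM h
  have hgN := hnot g hg hgR hgM
  have hgN' := hnot g' hg' hgR' hgM'
  have hNle : 2 * (g' * m) ≤ N := hN.trans (Nat.le_mul_of_pos_right _ (Nat.pos_of_ne_zero hM))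
  have hg2 : (2 : ℚ) ≤ g := by exact_mod_cast hg.two_le
  have hmq : (2 : ℚ) ≤ m := by exact_mod_cast hm
  have hNq : (0 : ℚ) < N := by exact_mod_cast Nat.pos_of_ne_zero hN0
  have hg'q : (0 : ℚ) < g' := by exact_mod_cast hg'.pos
  have hgq : (0 : ℚ) < g := by linarith
  have hm0 : (0 : ℚ) < m := by linarith
  have hminv : (1 : ℚ) / m ≤ 1 / 2 := one_div_le_one_div_of_le (by norm_num) hmq
  have hginv : (3 : ℚ) / (4 * g) ≤ 3 / 8 := by
    rw [div_le_div_iff₀ (by positivity) (by norm_num)]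
    linarith
  -- The error is below `1 / 2 ^ L ≤ 1 / (8 * g)`, so the remainder times `g` lies in `[3 / 4, 7 /
  -- 8]`.
  obtain ⟨S, hScard, hSdvd, hmS, z, hSz, hzy, hzL⟩ :=
    exists_hasUnitSum_near (L := L) hm (y := 1 - 1 / m - 3 / (4 * g)) (by linarith)
      (by have : (0 : ℚ) < 3 / (4 * g) := by positivity
          linarith)
  have hSN : ∀ n ∈ S, n ∣ N := fun n hn => ((hSdvd n hn).trans hL).mul_left _
  obtain ⟨A, hA⟩ : ∃ A : ℕ, z = A / N := by
    refine ⟨∑ n ∈ S, N / n, ?_⟩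
    rw [← hSz.2]
    push_cast
    rw [sum_div]
    refine sum_congr rfl fun n hn => ?_
    have hn0 : (n : ℚ) ≠ 0 := by
      have : n ≠ 0 := fun h => hSz.1 (h ▸ hn)
      exact_mod_cast this
    rw [Nat.cast_div (hSN n hn) hn0]
    field_simp
  have hlow : (3 : ℚ) / (4 * g) ≤ 1 - 1 / m - z := by linarith
  have hhigh : 1 - 1 / m - z ≤ 7 / (8 * g : ℚ) := by
    have h1 : (8 * g : ℚ) ≤ 2 ^ L := by exact_mod_cast hgL
    set δ := 1 - 1 / (m : ℚ) - 3 / (4 * g) - z with hδ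
    have hδ0 : 0 ≤ δ := by linarith
    have h2 : δ ≤ 1 / (8 * g : ℚ) := by
      rw [le_div_iff₀ (by positivity)]
      exact (mul_le_mul_of_nonneg_left h1 hδ0).trans hzL.le
    have h3 : (3 : ℚ) / (4 * g) + 1 / (8 * g) = 7 / (8 * g) := by
      field_simp; norm_num
    linarith
  obtain ⟨W, hW⟩ : ∃ W : ℕ, (W : ℚ) = (1 - 1 / m - z) * (m * N) := by
    have h1 : (1 - 1 / m - z) * (m * N) = (m : ℚ) * N - (N + m * A) := by
      rw [hA]; field_simp; ring
    have h2 : N + m * A ≤ m * N := by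
      have : 0 ≤ (1 - 1 / m - z) * (m * N) := by
        refine mul_nonneg (le_trans (by positivity) hlow) (by positivity)
      rw [h1] at this
      have : ((N + m * A : ℕ) : ℚ) ≤ (m * N : ℕ) := by push_cast; linarith
      exact_mod_cast this
    exact ⟨m * N - (N + m * A), by rw [h1, Nat.cast_sub h2]; push_cast; ring⟩
  have hWlow : 3 * (m * N) ≤ 4 * (g * W) := by
    have : (3 * (m * N) : ℚ) ≤ 4 * (g * W) := by
      rw [hW]
      rw [div_le_iff₀ (by positivity)] at hlow
      nlinarith [mul_pos hm0 hNq]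
    exact_mod_cast this
  have hWhigh : 8 * (g * W) ≤ 7 * (m * N) := by
    have : (8 * (g * W) : ℚ) ≤ 7 * (m * N) := by
      rw [hW]
      rw [le_div_iff₀ (by positivity)] at hhigh
      nlinarith [mul_pos hm0 hNq]
    exact_mod_cast this
  set G := g' * m with hG
  set U := g' * (g * W) with hU
  have hG4 : 4 ≤ G := Nat.mul_le_mul hg'.two_le hm
  have hU1 : 3 * (G * N) ≤ 4 * U := by
    calc 3 * (G * N) = g' * (3 * (m * N)) := by rw [hG]; ring
      _ ≤ g' * (4 * (g * W)) := Nat.mul_le_mul_left _ hWlow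
      _ = 4 * U := by rw [hU]; ring
  have hU2 : 8 * U ≤ 7 * (G * N) := by
    calc 8 * U = g' * (8 * (g * W)) := by rw [hU]; ring
      _ ≤ g' * (7 * (m * N)) := Nat.mul_le_mul_left _ hWhigh
      _ = 7 * (G * N) := by rw [hG]; ring
  have hGN : 4 * N ≤ G * N := Nat.mul_le_mul_right _ hG4
  -- The remainder of `1` is `U / (g * G * N)`. Division by `G` is shifted by half of `N` to put `r`
  -- in the upper half; `2 * G ≤ N` keeps it below `N`.
  obtain ⟨n, r, hnr, hr1, hr2⟩ : ∃ n r, G * n + r = U ∧ N ≤ 2 * r ∧ r < N := by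
    have hG0 : 0 < G := by omega
    have h1 := Nat.div_add_mod (U - (N + 1) / 2) G
    have h2 := Nat.mod_lt (U - (N + 1) / 2) hG0
    exact ⟨(U - (N + 1) / 2) / G, (U - (N + 1) / 2) % G + (N + 1) / 2, by omega, by omega, by omega⟩
  have hn1 : n < N := by
    refine Nat.lt_of_mul_lt_mul_left (a := G) ?_
    omega
  have hn2 : N ≤ 2 * n := by
    refine Nat.le_of_mul_le_mul_left (c := G) ?_ (by omega)
    have : G * (2 * n) = 2 * (G * n) := by ring
    omega
  obtain ⟨E₁, hE₁c, hE₁d, hE₁⟩ :=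
    (hupper n hn1 (by omega)).exists_hasUnitSum hN0 hg.ne_zero
  obtain ⟨E₂, hE₂c, hE₂d, hE₂⟩ :=
    (hupper r hr2 (by omega)).exists_hasUnitSum (c := g * G) hN0
      (mul_ne_zero hg.ne_zero (by omega))
  have hd1 : Disjoint {m} S := disjoint_singleton_left.2 hmS
  have hd2 : Disjoint ({m} ∪ S) E₁ := by
    rw [Finset.disjoint_left]
    intro a ha ha1
    have hga := (hE₁d a ha1).1
    rcases mem_union.1 ha with ha | ha
    · rw [mem_singleton.1 ha] at hga
      exact hgm hga
    · exact hgN (hga.trans (hSN a ha))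
  have hd3 : Disjoint ({m} ∪ S ∪ E₁) E₂ := by
    rw [Finset.disjoint_left]
    intro a ha ha2
    have hga := (hE₂d a ha2).1
    rcases mem_union.1 ha with ha | ha
    · rcases mem_union.1 ha with ha | ha
      · rw [mem_singleton.1 ha] at hga
        exact hgm ((dvd_mul_right _ _).trans hga)
      · exact hgN (((dvd_mul_right _ _).trans hga).trans (hSN a ha))
    · have h1 : g' ∣ g * N :=
        (((dvd_mul_right g' m).mul_left g).trans hga).trans (hE₁d a ha).2
      rcases hg'.dvd_mul.1 h1 with h | h
      · exact hgg' ((Nat.prime_dvd_prime_iff_eq hg' hg).1 h).symm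
      · exact hgN' h
  have hsum := (((hasUnitSum_singleton (m := m) (by omega)).union hSz hd1).union hE₁ hd2).union
    hE₂ hd3
  refine ⟨{m} ∪ S ∪ E₁ ∪ E₂, by simp, ?_, ?_, ?_⟩
  · have hE₂ne : E₂.Nonempty := by
      rw [nonempty_iff_ne_empty]
      rintro rfl
      have h1 := hE₂.2
      rw [sum_empty] at h1
      have : (0 : ℚ) < r := by
        have : 0 < r := by omega
        exact_mod_cast this
      have hGq : (0 : ℚ) < G := by
        have : 0 < G := by omega
        exact_mod_cast this
      have : (0 : ℚ) < r / ((g * G : ℕ) * N) := by push_cast; positivity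
      linarith
    obtain ⟨e, he⟩ := hE₂ne
    refine ⟨e, mem_union_right _ he, ?_⟩
    have he0 : 0 < e := Nat.pos_of_ne_zero fun h => hE₂.1 (h ▸ he)
    have h1 := Nat.le_of_dvd he0 (hE₂d e he).1
    have h2 : 2 * (2 * m) ≤ g * G :=
      Nat.mul_le_mul hg.two_le (Nat.mul_le_mul_right _ hg'.two_le)
    omega
  · convert hsum using 1
    have hnr' : (G * n + r : ℚ) = g' * (g * W) := by exact_mod_cast hnr
    rw [hW] at hnr'
    have hGq : (G : ℚ) = g' * m := by rw [hG]; push_cast; ring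
    have h1 : (n : ℚ) / (g * N) + r / ((g * G : ℕ) * N) = (G * n + r) / (g * G * N) := by
      push_cast
      rw [hGq]
      field_simp
    rw [add_assoc _ ((n : ℚ) / (g * N)), h1, hnr', hGq]
    field_simp
    ring
  · have h1 := card_union_le ({m} ∪ S ∪ E₁) E₂
    have h2 := card_union_le ({m} ∪ S) E₁
    have h3 := card_union_le {m} S
    rw [card_singleton] at h3
    omega

/-! ### Supply of primes -/

theorem two_pow_le_mul_primeCounting {j : ℕ} (hj : 0 < j) :
    2 ^ j ≤ j * Nat.primeCounting (2 ^ j) + (j + 1) := by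
  have h := Chebyshev.pi_ge (2 ^ j)
  have hlog2 : 0 < Real.log 2 := Real.log_pos (by norm_num)
  have hj' : (0 : ℝ) < j := by exact_mod_cast hj
  have h1 : Real.log ((2 ^ j : ℕ) + 1) ≤ (j + 1) * Real.log 2 := by
    have : ((j + 1 : ℕ) : ℝ) * Real.log 2 = Real.log (2 ^ (j + 1)) := (Real.log_pow _ _).symm
    push_cast at this
    rw [this]
    refine Real.log_le_log (by positivity) ?_
    have : (1 : ℝ) ≤ 2 ^ j := one_le_pow₀ (by norm_num)
    push_cast
    rw [pow_succ]
    linarith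
  have h2 : Real.log ((2 ^ j : ℕ) : ℝ) = j * Real.log 2 := by push_cast; exact Real.log_pow _ _
  rw [h2, div_le_iff₀ (by positivity)] at h
  have h3 : ((2 ^ j : ℕ) : ℝ) * Real.log 2 ≤
      (j * Nat.primeCounting (2 ^ j) + (j + 1)) * Real.log 2 := by
    linarith
  have h4 := le_of_mul_le_mul_right h3 hlog2
  exact_mod_cast h4

/-- The primes in the interval `[a, b]`. -/
def primesIcc (a b : ℕ) : Finset ℕ := {p ∈ Icc a b | p.Prime}

theorem mem_primesIcc {a b p : ℕ} : p ∈ primesIcc a b ↔ (a ≤ p ∧ p ≤ b) ∧ p.Prime := by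
  simp [primesIcc]

theorem primeCounting_le_card_primesIcc (a b : ℕ) :
    Nat.primeCounting b ≤ #(primesIcc a b) + a := by
  rw [← Nat.primesLE_card_eq_primeCounting]
  suffices h : Nat.primesLE b ⊆ primesIcc a b ∪ range a by
    simpa using (card_le_card h).trans (card_union_le _ _)
  intro p hp
  have h1 := Nat.prime_of_mem_primesLE hp
  have h2 : p ≤ b := Nat.le_of_mem_primesLE hp
  rw [mem_union, mem_primesIcc, mem_range]
  by_cases h : p < a
  · exact Or.inr h
  · exact Or.inl ⟨⟨by omega, h2⟩, h1⟩

theorem two_pow_ge_cube {κ : ℕ} (hκ : 32 ≤ κ) : 512 * κ ^ 3 ≤ 2 ^ κ := by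
  induction κ, hκ using Nat.le_induction with
  | base => norm_num
  | succ n hn ih =>
    have h1 : (n + 1) ^ 3 ≤ 2 * n ^ 3 := by nlinarith [mul_le_mul hn hn (by norm_num) (by omega)]
    rw [pow_succ 2 n]
    omega

theorem four_mul_add_two_le_two_pow {t : ℕ} (ht : 5 ≤ t) : 4 * (t + 2) ≤ 2 ^ t := by
  induction t, ht using Nat.le_induction with
  | base => norm_num
  | succ n hn ih => rw [pow_succ]; omega

theorem odd_of_mem_subsetProducts {P : Finset ℕ} (hP : ∀ p ∈ P, p.Prime ∧ 3 ≤ p) {x : ℕ}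
    (hx : x ∈ subsetProducts P) : Odd x := by
  obtain ⟨S, hS, rfl⟩ := mem_image.1 hx
  refine prod_induction _ Odd (fun _ _ => Odd.mul) odd_one fun p hp => ?_
  have h := hP p (mem_powerset.1 hS hp)
  exact h.1.odd_of_ne_two (by omega)

/-- Among sufficiently many primes, `n` of them do not divide `m` and keep at least half as many
residue classes of `X` and of `Y` as there are elements. -/
theorem exists_good_primes {K H m n a b : ℕ} {X Y : Finset ℕ} (hX : #X = 2 ^ K) (hY : #Y = 2 ^ K)
    (hXH : ∀ x ∈ X, x < 2 ^ H) (hYH : ∀ y ∈ Y, y < 2 ^ H) (hm0 : m ≠ 0) (hm : m < 2 ^ H)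
    (hcount : n + 2 * (2 * 2 ^ K * H) + H ≤ #(primesIcc a b)) :
    ∃ Q ⊆ primesIcc a b, #Q = n ∧ ∀ q ∈ Q, ¬ q ∣ m ∧
      2 ^ K ≤ 2 * #(X.image (Nat.cast : ℕ → ZMod q)) ∧
      2 ^ K ≤ 2 * #(Y.image (Nat.cast : ℕ → ZMod q)) := by
  set A := primesIcc a b
  have hA : ∀ q ∈ A, q.Prime := fun q hq => (mem_primesIcc.1 hq).2
  have h1 := card_primes_small_image_le X A H hXH hA
  have h2 := card_primes_small_image_le Y A H hYH hA
  have h3 := card_primes_dvd_le hm0 hm A hA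
  rw [hX] at h1
  rw [hY] at h2
  set B₁ := {q ∈ A | 2 * #(X.image (Nat.cast : ℕ → ZMod q)) < 2 ^ K}
  set B₂ := {q ∈ A | 2 * #(Y.image (Nat.cast : ℕ → ZMod q)) < 2 ^ K}
  set B₃ := {q ∈ A | q ∣ m}
  have h4 : n ≤ #(A \ (B₁ ∪ B₂ ∪ B₃)) := by
    have h5 := le_card_sdiff (B₁ ∪ B₂ ∪ B₃) A
    have h6 := card_union_le (B₁ ∪ B₂) B₃
    have h7 := card_union_le B₁ B₂
    omega
  obtain ⟨Q, hQ, hQn⟩ := exists_subset_card_eq h4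
  refine ⟨Q, hQ.trans sdiff_subset, hQn, fun q hq => ?_⟩
  have h8 := hQ hq
  simp only [B₁, B₂, B₃, mem_sdiff, mem_union, mem_filter, not_or, not_and, not_lt] at h8
  exact ⟨h8.2.2 h8.1, h8.2.1.1 h8.1, h8.2.1.2 h8.1⟩

theorem card_primesIcc_three_ge {t : ℕ} (ht : 5 ≤ t) :
    2 * 2 ^ (t + 2) ≤ #(primesIcc 3 ((2 ^ (t + 2)) ^ 2)) := by
  have h1 := two_pow_le_mul_primeCounting (j := 2 * (t + 2)) (by omega)
  rw [show 2 ^ (2 * (t + 2)) = (2 ^ (t + 2)) ^ 2 by ring] at h1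
  have h2 := primeCounting_le_card_primesIcc 3 ((2 ^ (t + 2)) ^ 2)
  by_contra hlt
  have h3 : Nat.primeCounting ((2 ^ (t + 2)) ^ 2) ≤ 2 * 2 ^ (t + 2) + 2 := by omega
  have h4 := Nat.mul_le_mul_left (2 * (t + 2)) h3
  have h5 := four_mul_add_two_le_two_pow ht
  have hK : 2 ^ (t + 2) = 4 * 2 ^ t := by rw [pow_add]; ring
  have h6 : (2 ^ (t + 2)) ^ 2 ≤ 2 * (t + 2) * (2 * 2 ^ (t + 2) + 2) + (2 * (t + 2) + 1) := by omega
  rw [hK] at h6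
  generalize 2 ^ t = κ at h5 h6
  nlinarith [Nat.mul_le_mul_right (16 * κ + 6) h5]

/-- With `K = 4 * κ`, the left side is the number of primes wanted plus the bound for the bad ones,
of order `2 ^ K * K ^ 2`. The Chebyshev bound `2 ^ (5 * κ) / (5 * κ)` wins because `2 ^ κ` exceeds
`512 * κ ^ 3`. -/
theorem card_primesIcc_two_pow_ge {κ : ℕ} (hκ : 32 ≤ κ) :
    4 * κ + 4 + 2 * (2 * 2 ^ (4 * κ) * (4 * κ) ^ 2) + (4 * κ) ^ 2 ≤
      #(primesIcc (2 ^ (4 * κ)) (2 ^ (5 * κ))) := by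
  have hcube := two_pow_ge_cube hκ
  have h1 := two_pow_le_mul_primeCounting (j := 5 * κ) (by omega)
  have h2 := primeCounting_le_card_primesIcc (2 ^ (4 * κ)) (2 ^ (5 * κ))
  by_contra hlt
  have h5 : 2 ^ (5 * κ) = 2 ^ (4 * κ) * 2 ^ κ := by rw [← pow_add]; congr 1; ring
  have h6 := Nat.mul_le_mul_left (2 ^ (4 * κ)) hcube
  rw [← h5] at h6
  have hE : 512 * κ ^ 3 ≤ 2 ^ (4 * κ) :=
    hcube.trans (Nat.pow_le_pow_right (by norm_num) (by omega))
  generalize 2 ^ (4 * κ) = E at *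
  generalize 2 ^ (5 * κ) = F at *
  generalize Nat.primeCounting F = π at *
  have hκ3 : 32 * κ ^ 2 ≤ κ ^ 3 := by
    rw [pow_succ κ 2, mul_comm]
    exact Nat.mul_le_mul_left _ hκ
  have hκ2 : 32 * κ ≤ κ ^ 2 := by
    rw [sq]
    exact Nat.mul_le_mul_right _ hκ
  have h7 : 4 * κ + 4 + (4 * κ) ^ 2 ≤ E := by
    rw [mul_pow]
    omega
  have h8 : π ≤ 64 * (E * κ ^ 2) + 2 * E := by
    have : 2 * (2 * E * (4 * κ) ^ 2) = 64 * (E * κ ^ 2) := by ring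
    omega
  have h9 := Nat.mul_le_mul_left (5 * κ) h8
  have h10 : 5 * κ * (64 * (E * κ ^ 2) + 2 * E) = 320 * (E * κ ^ 3) + 10 * (E * κ) := by ring
  have h11 : E * (512 * κ ^ 3) = 512 * (E * κ ^ 3) := by ring
  have h12 := Nat.mul_le_mul_left E (hκ3.trans' (Nat.mul_le_mul_left 32 hκ2))
  have h13 : E * (32 * (32 * κ)) = 1024 * (E * κ) := by ring
  have h14 : E ≤ E * κ := Nat.le_mul_of_pos_right _ (by omega)
  omega

/-! ### Choice of parameters and conclusion -/

theorem exists_hasUnitSum_one {s m : ℕ} (hs : 7 ≤ s) (hm : 1 < m) (hm' : m < 2 ^ (2 ^ s) ^ 2) :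
    ∃ S : Finset ℕ, m ∈ S ∧ (∃ e ∈ S, m < e) ∧ HasUnitSum S 1 ∧ #S ≤ 20 * 2 ^ s := by
  obtain ⟨t, rfl⟩ : ∃ t, s = t + 2 := ⟨s - 2, by omega⟩
  obtain ⟨κ, hκ⟩ : ∃ κ, κ = 2 ^ t := ⟨_, rfl⟩
  obtain ⟨K, hK⟩ : ∃ K, K = 2 ^ (t + 2) := ⟨_, rfl⟩
  have hKκ : K = 4 * κ := by rw [hK, hκ, pow_add]; ring
  have hκ32 : 32 ≤ κ := by
    rw [hκ]
    exact Nat.pow_le_pow_right (n := 2) (by norm_num) (show 5 ≤ t by omega)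
  have htκ : t < κ := hκ ▸ Nat.lt_two_pow_self
  have hcube := two_pow_ge_cube hκ32
  have hKsq : K ^ 2 < 2 ^ K := by
    have h1 : 2 ^ κ ≤ 2 ^ K := Nat.pow_le_pow_right (by norm_num) (by omega)
    have h2 : K ^ 2 < 512 * κ ^ 3 := by rw [hKκ]; nlinarith
    omega
  rw [← hK] at hm' ⊢
  -- the small primes
  obtain ⟨P, hP, hPcard⟩ : ∃ P ⊆ primesIcc 3 (K ^ 2), #P = 2 * K := by
    exact exists_subset_card_eq (hK ▸ card_primesIcc_three_ge (by omega))
  have hPprime : ∀ p ∈ P, p.Prime ∧ 3 ≤ p ∧ p ≤ K ^ 2 := fun p hp => by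
    have := mem_primesIcc.1 (hP hp)
    exact ⟨this.2, this.1⟩
  obtain ⟨P₁, hP₁, hP₁card⟩ := exists_subset_card_eq (s := P) (n := K) (by omega)
  have hP₂card : #(P \ P₁) = K := by
    rw [card_sdiff_of_subset hP₁]; omega
  set P₂ := P \ P₁ with hP₂def
  have hP₂ : P₂ ⊆ P := sdiff_subset
  set B := K.factorial * 2 ^ (2 * K) with hB
  have hB0 : B ≠ 0 := mul_ne_zero (Nat.factorial_ne_zero _) (by positivity)
  set M := (∏ p ∈ P, p) * B with hMdef
  have hM0 : M ≠ 0 := mul_ne_zero (prod_ne_zero_iff.2 fun p hp => (hPprime p hp).1.ne_zero) hB0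
  have hprac : IsPractical M (2 * K + K + 2 * (2 * K)) := by
    rw [← hPcard]
    have h := ((isPractical_two_pow (2 * K)).factorial_mul (by positivity) K).prod_mul (b := K) hB0
      (fun j hj hjK => (Nat.dvd_factorial hj hjK.le).mul_right _) (fun j hj hjK => ?_) P
      fun p hp => ⟨(hPprime p hp).1.pos, by rw [← sq]; exact (hPprime p hp).2.2⟩
    · rwa [hPcard] at h ⊢
    · rw [mul_comm K j]
      refine Nat.mul_dvd_mul (Nat.dvd_factorial hj hjK.le) ?_
      conv_lhs => rw [hK]
      exact pow_dvd_pow _ (by omega)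
  set X := subsetProducts P₁ with hXdef
  set Y := subsetProducts P₂ with hYdef
  have hXc : #X = 2 ^ K := by
    rw [hXdef, card_subsetProducts fun p hp => (hPprime p (hP₁ hp)).1, hP₁card]
  have hYc : #Y = 2 ^ K := by
    rw [hYdef, card_subsetProducts fun p hp => (hPprime p (hP₂ hp)).1, hP₂card]
  have hbound : ∀ P' ⊆ P, #P' = K → ∀ x ∈ subsetProducts P', x < 2 ^ K ^ 2 := by
    intro P' hP' hcard x hx
    have hpos : 0 < ∏ p ∈ P', p := prod_pos fun p hp => (hPprime p (hP' hp)).1.pos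
    calc x ≤ ∏ p ∈ P', p := Nat.le_of_dvd hpos (dvd_prod_of_mem_subsetProducts hx)
      _ ≤ ∏ p ∈ P', K ^ 2 := prod_le_prod' fun p hp => (hPprime p (hP' hp)).2.2
      _ = (K ^ 2) ^ K := by rw [prod_const, hcard]
      _ < (2 ^ K) ^ K := Nat.pow_lt_pow_left hKsq (by omega)
      _ = 2 ^ K ^ 2 := by rw [← pow_mul, sq]
  -- the large primes
  obtain ⟨Q, hQ, hQcard, hQgood⟩ := exists_good_primes (n := K + 4) (a := 2 ^ K) (b := 2 ^ (5 * κ))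
    hXc hYc (hbound P₁ hP₁ hP₁card) (hbound P₂ hP₂ hP₂card) (by omega) hm'
    (hKκ ▸ card_primesIcc_two_pow_ge hκ32)
  have hQprime : ∀ q ∈ Q, q.Prime ∧ 2 ^ K ≤ q ∧ q ≤ 2 ^ (5 * κ) := fun q hq => by
    have := mem_primesIcc.1 (hQ hq)
    exact ⟨this.2, this.1⟩
  have h16 : 16 ≤ 2 ^ K := by
    exact Nat.pow_le_pow_right (n := 2) (by norm_num) (show 4 ≤ K by omega)
  have hQM : ∀ q ∈ Q, ¬ q ∣ M := by
    intro q hq h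
    obtain ⟨hqp, hqK, -⟩ := hQprime q hq
    rcases hqp.dvd_mul.1 h with h | h
    · obtain ⟨p, hp, hqp'⟩ := (hqp.prime.dvd_finsetProd_iff _).1 h
      have h1 := hPprime p hp
      have h2 := Nat.le_of_dvd h1.1.pos hqp'
      omega
    · rcases hqp.dvd_mul.1 h with h | h
      · have h1 := (hqp.dvd_factorial).1 h
        have h2 : K < 2 ^ K := Nat.lt_two_pow_self
        omega
      · have := Nat.le_of_dvd (by norm_num) (hqp.dvd_of_dvd_pow h)
        omega
  have hcov : ∀ q ∈ Q, DivisorsCover M q := by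
    intro q hq
    obtain ⟨hqp, hqK, hqκ⟩ := hQprime q hq
    obtain ⟨-, hgX, hgY⟩ := hQgood q hq
    refine divisorsCover_of_card hM0 hqp (by omega) X Y
      (fun x hx => odd_of_mem_subsetProducts (fun p hp => ?_) hx)
      (fun y hy => ⟨odd_of_mem_subsetProducts (fun p hp => ?_) hy, fun hqy => ?_⟩)
      (fun x hx y hy => ?_) ?_
    · exact ⟨(hPprime p (hP₁ hp)).1, (hPprime p (hP₁ hp)).2.1⟩
    · exact ⟨(hPprime p (hP₂ hp)).1, (hPprime p (hP₂ hp)).2.1⟩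
    · exact hQM q hq (((hqy.trans (dvd_prod_of_mem_subsetProducts hy)).trans
        (prod_dvd_prod_of_subset _ _ _ hP₂)).mul_right _)
    · rw [mul_comm 2, hMdef]
      refine Nat.mul_dvd_mul ?_ ((dvd_pow_self 2 (by omega)).mul_left _)
      rw [← prod_sdiff hP₁, mul_comm]
      exact Nat.mul_dvd_mul (dvd_prod_of_mem_subsetProducts hy) (dvd_prod_of_mem_subsetProducts hx)
    · set x := #(X.image (Nat.cast : ℕ → ZMod q))
      set y := #(Y.image (Nat.cast : ℕ → ZMod q))
      have h1 : 2 ^ K * 2 ^ K ≤ 4 * (x * y) := by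
        calc 2 ^ K * 2 ^ K ≤ (2 * x) * (2 * y) := Nat.mul_le_mul hgX hgY
          _ = 4 * (x * y) := by ring
      have h2 : 2 ^ (4 * K) ≤ 2 ^ 4 * (x * y) ^ 2 := by
        calc 2 ^ (4 * K) = (2 ^ K * 2 ^ K) ^ 2 := by ring
          _ ≤ (4 * (x * y)) ^ 2 := Nat.pow_le_pow_left h1 2
          _ = _ := by ring
      have h3 : 2 ^ 4 * q ^ 3 < 2 ^ (4 * K) := by
        calc 2 ^ 4 * q ^ 3 ≤ 2 ^ 4 * (2 ^ (5 * κ)) ^ 3 :=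
              Nat.mul_le_mul_left _ (Nat.pow_le_pow_left hqκ 3)
          _ = 2 ^ (4 + 5 * κ * 3) := by rw [← pow_mul, ← pow_add]
          _ < 2 ^ (4 * K) := Nat.pow_lt_pow_right (by norm_num) (by omega)
      omega
  -- the two markers
  obtain ⟨g, hgQ⟩ : Q.Nonempty := card_pos.1 (by omega)
  obtain ⟨g', hgQ'⟩ : (Q.erase g).Nonempty := card_pos.1 (by rw [card_erase_of_mem hgQ]; omega)
  set R := (Q.erase g).erase g' with hRdef
  have hRcard : #R = K + 2 := by
    rw [hRdef, card_erase_of_mem hgQ', card_erase_of_mem hgQ]; omega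
  have hRQ : ∀ q ∈ R, q ∈ Q := fun q hq => mem_of_mem_erase (mem_of_mem_erase hq)
  have hgQ'' : g' ∈ Q := mem_of_mem_erase hgQ'
  have hL : 2 ^ (5 * κ + 3) = 8 * 2 ^ (5 * κ) := by rw [pow_add]; ring
  obtain ⟨S, h1, h2, h3, h4⟩ := exists_hasUnitSum_one_of_primes (L := 5 * κ + 3) (R := R) (g := g)
    (g' := g') hM0 hprac hm
    (fun q hq => ⟨(hQprime q (hRQ q hq)).1, h16.trans (hQprime q (hRQ q hq)).2.1,
      hQM q (hRQ q hq), hcov q (hRQ q hq)⟩)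
    (hQprime g hgQ).1 (hQprime g' hgQ'').1 (ne_of_mem_erase hgQ').symm
    (fun h => notMem_erase g Q (mem_of_mem_erase h)) (notMem_erase g' _)
    (hQgood g hgQ).1 (hQM g hgQ) (hQM g' hgQ'')
    ((Nat.mul_dvd_mul (Nat.dvd_factorial (by norm_num) (by omega))
      (pow_dvd_pow _ (by omega))).mul_left _)
    (by rw [hL]; exact Nat.mul_le_mul_left _ (hQprime g hgQ).2.2)
    (by
      have h1 : (2 ^ K) ^ (K + 2) ≤ ∏ q ∈ R, q := by
        rw [← hRcard, ← prod_const]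
        exact prod_le_prod' fun q hq => (hQprime q (hRQ q hq)).2.1
      refine le_trans ?_ h1
      calc 2 * (g' * m) ≤ 2 * (2 ^ (5 * κ) * 2 ^ K ^ 2) :=
            Nat.mul_le_mul_left _ (Nat.mul_le_mul (hQprime g' hgQ'').2.2 hm'.le)
        _ = 2 ^ (1 + 5 * κ + K ^ 2) := by rw [pow_add, pow_add]; ring
        _ ≤ 2 ^ (K * (K + 2)) := Nat.pow_le_pow_right (by norm_num) (by
            have : K * (K + 2) = K ^ 2 + 2 * K := by ring
            omega)
        _ = _ := by rw [← pow_mul])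
  refine ⟨S, h1, h2, h3, h4.trans ?_⟩
  rw [hRcard]
  omega

theorem mem_unitFractionDenominators_of_lt {s m k : ℕ} (hs : 7 ≤ s) (hk : 20 * 2 ^ s ≤ k)
    (hm : 1 < m) (hm' : m < 2 ^ (2 ^ s) ^ 2) : m ∈ unitFractionDenominators k := by
  obtain ⟨S, h1, h2, h3, h4⟩ := exists_hasUnitSum_one hs hm hm'
  obtain ⟨S', h5, h6, h7⟩ := exists_hasUnitSum_card_eq hm.le k S h1 h2 h3 (h4.trans hk)
  exact mem_unitFractionDenominators h5 h6 h7

theorem theorem1 :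
    ∃ c : ℝ, 0 < c ∧ ∀ k : ℕ, 1 ≤ k →
      IsLeast {m : ℕ | 1 < m ∧ m ∉ unitFractionDenominators k} (smallestNonDenominator k) ∧
      Real.exp (c * (k : ℝ) ^ 2) ≤ (smallestNonDenominator k : ℝ) := by
  have hlog2 : 0 < Real.log 2 := Real.log_pos (by norm_num)
  -- Here `2560 = 20 * 2 ^ 7` is the least `k` covered by the construction; below it, `v ≥ 2`
  -- suffices.
  refine ⟨Real.log 2 / 2560 ^ 2, by positivity, fun k hk => ?_⟩
  have hleast := isLeast_smallestNonDenominator k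
  refine ⟨hleast, ?_⟩
  obtain ⟨⟨hv1, hv2⟩, -⟩ := hleast
  set v := smallestNonDenominator k
  suffices H : ∃ j : ℕ, 2 ^ j ≤ v ∧ k ^ 2 ≤ 2560 ^ 2 * j by
    obtain ⟨j, h1, h2⟩ := H
    have h2' : (k : ℝ) ^ 2 ≤ 2560 ^ 2 * j := by exact_mod_cast h2
    calc Real.exp (Real.log 2 / 2560 ^ 2 * (k : ℝ) ^ 2)
        ≤ Real.exp (Real.log 2 / 2560 ^ 2 * (2560 ^ 2 * j)) := by gcongr
      _ = Real.exp (j * Real.log 2) := by congr 1; field_simp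
      _ = 2 ^ j := by rw [Real.exp_nat_mul, Real.exp_log (by norm_num)]
      _ ≤ v := by exact_mod_cast h1
  rcases Nat.lt_or_ge k 2560 with hsmall | hlarge
  · exact ⟨1, by omega, by nlinarith⟩
  · have h0 : k / 20 ≠ 0 := by omega
    have h1 := Nat.pow_log_le_self 2 h0
    have h2 := Nat.lt_pow_succ_log_self (b := 2) (by norm_num) (k / 20)
    have h3 : 7 ≤ Nat.log 2 (k / 20) := by
      refine (Nat.le_log_iff_pow_le (by norm_num) h0).2 ?_
      norm_num
      omega
    set s := Nat.log 2 (k / 20)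
    refine ⟨(2 ^ s) ^ 2, ?_, ?_⟩
    · by_contra! hlt
      exact hv2 (mem_unitFractionDenominators_of_lt h3 (by omega) hv1 hlt)
    · rw [pow_succ] at h2
      rw [← mul_pow]
      exact Nat.pow_le_pow_left (by omega) 2
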